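/- Let $G$ be a countably infinite discrete amenable group acting by homeomorphisms on an infinite compact metrizable space $X$, and suppose that the action is minimal (every orbit is dense) and free ($gx=x$ for some $x\in X$ implies $g=1$). Let $M_G(X)$ be the set of $G$-invariant Borel probability measures on $X$, with the weak* topology, and let $E_G(X)\subseteq M_G(X)$ be the subspace of ergodic measures. If $E_G(X)$ is compact and zero-dimensional (its clopen subsets form a basis of its topology), then the action has the small boundary property: for every $x\in X$ and every open set $U\ni x$ there is an open set $V$ with $x\in V\subseteq U$ such that $\mu(\partial V)=0$ for every $\mu\in M_G(X)$. -/

import Mathlib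

open MeasureTheory TopologicalSpace

namespace SmallBoundary

open scoped Pointwise symmDiff

open Classical in
/-- A discrete group is amenable: every finite subset `K` and every `ε > 0` admit a nonempty finite
set `F` that is `ε`-invariant under left translation by the elements of `K`, that is,
`|gF ∆ F| ≤ ε |F|` for all `g ∈ K`. -/
def IsAmenable (G : Type*) [Group G] : Prop :=
  ∀ (K : Finset G) (ε : ℝ), 0 < ε → ∃ F : Finset G, F.Nonempty ∧
    ∀ g ∈ K, (((g • F) ∆ F).card : ℝ) ≤ ε * (F.card : ℝ)

/-- The action is free: only the identity has a fixed point. -/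
def IsFreeAction (G X : Type*) [Group G] [MulAction G X] : Prop :=
  ∀ (g : G) (x : X), g • x = x → g = 1

/-- `M_G(X)`: the invariant Borel probability measures, as a subset of the space of Borel
probability measures with its weak* topology (tested against bounded continuous functions). On a
compact metrizable space every Borel probability measure is regular. -/
def invariantMeasures (G X : Type*) [Group G] [MulAction G X] [MeasurableSpace X] :
    Set (ProbabilityMeasure X) :=
  {μ | SMulInvariantMeasure G X (μ : Measure X)}

/-- `E_G(X)`: the ergodic measures in `M_G(X)` (`ErgodicSMul` includes invariance). -/
def ergodicMeasures (G X : Type*) [Group G] [MulAction G X] [MeasurableSpace X] :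
    Set (ProbabilityMeasure X) :=
  {μ | ErgodicSMul G X (μ : Measure X)}

/-- A topological space is zero-dimensional if its clopen subsets form a basis. -/
def IsZeroDimensional (Y : Type*) [TopologicalSpace Y] : Prop :=
  IsTopologicalBasis {s : Set Y | IsClopen s}

/-- The small boundary property: every point has arbitrarily small open neighbourhoods whose
boundary is null for all invariant Borel probability measures simultaneously. -/
def HasSmallBoundaryProperty (G X : Type*) [Group G] [MulAction G X] [TopologicalSpace X]
    [MeasurableSpace X] : Prop :=
  ∀ (x : X) (U : Set X), IsOpen U → x ∈ U →
    ∃ V : Set X, IsOpen V ∧ x ∈ V ∧ V ⊆ U ∧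
      ∀ μ ∈ invariantMeasures G X, (μ : Measure X) (frontier V) = 0

end SmallBoundary

/-! A Baire category argument in `C(X, ℝ)`: for a dense set of `g`, the set `{g = 0}` is null for
all ergodic measures at once. If `g` is positive at `x` and negative off `U`, then `{g > 0}` is the
required neighbourhood. Its boundary lies in `{g = 0}`, and for a closed set being null passes from
ergodic to all invariant measures (`exists_ergodic_measure_closed_ge`).

For Baire, having zero set of measure `< c` for all ergodic measures is an open condition, by
compactness. For density, perturb `f`. For a single `μ`, all but countably many levels of `f` are
null. Zero-dimensionality lets a nearly null level be chosen continuously in `μ`, giving a shift `t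
μ` (`exists_continuous_level`). A continuous `θ` on `X` then simulates all these shifts together,
being close to the constant `t μ` in `L¹(μ)`, uniformly in `μ` (`mem_meanApproximable`). Its
existence combines Følner averages with Stone–Weierstrass. Adding `θ`, clamped to be small, gives
the perturbation. -/

namespace SmallBoundary

open scoped Pointwise symmDiff Topology ENNReal

/-! ### Invariant measures and domination by ergodic ones -/

section Measures

variable {G X : Type*} [Group G] [TopologicalSpace X] [CompactSpace X] [MetrizableSpace X]
  [MeasurableSpace X] [BorelSpace X] [MulAction G X] [ContinuousConstSMul G X]

theorem integrable_of_continuous {f : X → ℝ} (hf : Continuous f) (μ : Measure X)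
    [IsFiniteMeasure μ] : Integrable f μ :=
  hf.integrable_of_hasCompactSupport (HasCompactSupport.of_compactSpace f)

omit [CompactSpace X] in
/-- The measure of a closed set is an upper semicontinuous function of the measure. -/
theorem upperSemicontinuous_measure_closed {K : Set X} (hK : IsClosed K) :
    UpperSemicontinuous fun μ : ProbabilityMeasure X ↦ (μ : Measure X) K := by
  intro μ c hc
  exact Filter.eventually_lt_of_limsup_lt
    ((ProbabilityMeasure.limsup_measure_closed_le_of_tendsto Filter.tendsto_id hK).trans_lt hc)

omit [CompactSpace X] in
theorem isOpen_setOf_measure_closed_lt {K : Set X} (hK : IsClosed K) (c : ℝ≥0∞) :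
    IsOpen {μ : ProbabilityMeasure X | (μ : Measure X) K < c} :=
  (upperSemicontinuous_measure_closed hK).isOpen_preimage c

omit [CompactSpace X] in
theorem isClosed_invariantMeasures : IsClosed (invariantMeasures G X) := by
  have h : invariantMeasures G X = ⋂ g : G, {μ : ProbabilityMeasure X |
      μ.map (continuous_const_smul g).measurable.aemeasurable = μ} := by
    ext μ
    simp only [invariantMeasures, Set.mem_ofPred_eq, Set.mem_iInter]
    constructor
    · intro hμ g
      apply Subtype.ext
      exact MeasureTheory.map_smul (μ := (μ : Measure X)) g
    · intro hμ
      refine ⟨fun g s hs ↦ ?_⟩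
      have h1 := congrArg (fun ν : ProbabilityMeasure X ↦ (ν : Measure X) s) (hμ g)
      rw [← Measure.map_apply (continuous_const_smul g).measurable hs]
      exact h1
  rw [h]
  exact isClosed_iInter fun g ↦
    isClosed_eq (ProbabilityMeasure.continuous_map (continuous_const_smul g)) continuous_id

omit [CompactSpace X] in
theorem probabilityMeasure_ext_of_integral {μ ν : ProbabilityMeasure X}
    (h : ∀ φ : C(X, ℝ), ∫ x, φ x ∂(μ : Measure X) = ∫ x, φ x ∂(ν : Measure X)) : μ = ν := by
  apply Subtype.ext
  exact ext_of_forall_integral_eq_of_IsFiniteMeasure (μ := (μ : Measure X))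
    (ν := (ν : Measure X)) fun f ↦ h f.toContinuousMap

omit [TopologicalSpace X] [CompactSpace X] [MetrizableSpace X] [BorelSpace X]
  [ContinuousConstSMul G X] in
/-- Conditioning an invariant measure on an almost invariant set gives an invariant measure. -/
theorem smulInvariantMeasure_cond [MeasurableConstSMul G X] {μ : Measure X}
    [SMulInvariantMeasure G X μ]
    {s : Set X} (hs : MeasurableSet s) (h : ∀ g : G, (g • ·) ⁻¹' s =ᵐ[μ] s) :
    SMulInvariantMeasure G X (ProbabilityTheory.cond μ s) := by
  refine ⟨fun g t ht ↦ ?_⟩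
  rw [ProbabilityTheory.cond_apply hs, ProbabilityTheory.cond_apply hs]
  congr 1
  calc μ (s ∩ (g • ·) ⁻¹' t) = μ ((g • ·) ⁻¹' s ∩ (g • ·) ⁻¹' t) :=
        measure_congr ((h g).symm.inter (ae_eq_refl _))
    _ = μ (s ∩ t) := by
        rw [← Set.preimage_inter]
        exact measure_preimage_smul_of_nullMeasurableSet (hs.inter ht).nullMeasurableSet g

/-- The evaluation of every invariant measure at a closed set is dominated by that of an ergodic
measure. -/
theorem exists_ergodic_measure_closed_ge {μ : ProbabilityMeasure X}
    (hμ : μ ∈ invariantMeasures G X) {K : Set X} (hK : IsClosed K) :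
    ∃ ν ∈ ergodicMeasures G X, (μ : Measure X) K ≤ (ν : Measure X) K := by
  obtain ⟨ν₀, hν₀, hmax⟩ := UpperSemicontinuousOn.exists_isMaxOn ⟨μ, hμ⟩
    (isClosed_invariantMeasures (G := G) (X := X)).isCompact
    ((upperSemicontinuous_measure_closed hK).upperSemicontinuousOn _)
  set c := (ν₀ : Measure X) K with hc
  -- The invariant measures that maximise the mass of `K`; they form a compact face, whose extreme
  -- points will be ergodic.
  let S : Set (ProbabilityMeasure X) := invariantMeasures G X ∩ {ν | c ≤ (ν : Measure X) K}
  have hS : IsCompact S := (isClosed_invariantMeasures.inter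
    ((upperSemicontinuous_measure_closed hK).isClosed_preimage c)).isCompact
  -- `J` moves the problem into a locally convex vector space, where Krein–Milman supplies extreme
  -- points.
  let J : ProbabilityMeasure X → C(X, ℝ) → ℝ := fun ν φ ↦ ∫ x, φ x ∂(ν : Measure X)
  have hJ : Continuous J := continuous_pi fun φ ↦
    ProbabilityMeasure.continuous_integral_continuousMap φ
  obtain ⟨_, ⟨⟨ν, hν, rfl⟩, hext⟩⟩ := (hS.image hJ).extremePoints_nonempty
    (⟨_, ν₀, ⟨hν₀, le_refl c⟩, rfl⟩)
  refine ⟨ν, ?_, (hmax hμ).trans hν.2⟩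
  have hinv : SMulInvariantMeasure G X (ν : Measure X) := hν.1
  refine ⟨fun {s} hs hgs ↦ ?_⟩
  -- A nontrivial almost invariant `s` splits `ν` into its conditionings on `s` and `sᶜ`,
  -- contradicting extremality.
  by_contra H
  obtain ⟨h0, h1⟩ : (ν : Measure X) s ≠ 0 ∧ (ν : Measure X) sᶜ ≠ 0 := by
    simpa [Filter.eventuallyConst_set, ae_iff, and_comm] using! H
  have hgs' : ∀ g : G, (g • ·) ⁻¹' sᶜ =ᵐ[(ν : Measure X)] sᶜ := fun g ↦ (hgs g).compl
  have i1 := ProbabilityTheory.cond_isProbabilityMeasure h0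
  have i2 := ProbabilityTheory.cond_isProbabilityMeasure h1
  let α : ProbabilityMeasure X := ⟨ProbabilityTheory.cond (ν : Measure X) s, i1⟩
  let β : ProbabilityMeasure X := ⟨ProbabilityTheory.cond (ν : Measure X) sᶜ, i2⟩
  have hα : α ∈ invariantMeasures G X := smulInvariantMeasure_cond hs hgs
  have hβ : β ∈ invariantMeasures G X := smulInvariantMeasure_cond hs.compl hgs'
  have hdecomp : (ν : Measure X) =
      (ν : Measure X) s • (α : Measure X) + (ν : Measure X) sᶜ • (β : Measure X) := by
    ext t ht
    simp only [Measure.add_apply, Measure.smul_apply, smul_eq_mul, α, β, ProbabilityMeasure.coe_mk,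
      ProbabilityTheory.cond_apply hs, ProbabilityTheory.cond_apply hs.compl]
    rw [← mul_assoc, ← mul_assoc, ENNReal.mul_inv_cancel h0 (measure_ne_top _ _),
      ENNReal.mul_inv_cancel h1 (measure_ne_top _ _), one_mul, one_mul, Set.inter_comm,
      Set.inter_comm sᶜ, ← Set.sdiff_eq, measure_inter_add_sdiff t hs]
  set a := ((ν : Measure X) s).toReal with ha
  set b := ((ν : Measure X) sᶜ).toReal with hb
  have ha0 : 0 < a := ENNReal.toReal_pos h0 (measure_ne_top _ _)
  have hb0 : 0 < b := ENNReal.toReal_pos h1 (measure_ne_top _ _)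
  have hab : a + b = 1 := by
    rw [ha, hb, ← ENNReal.toReal_add (measure_ne_top _ _) (measure_ne_top _ _),
      measure_add_measure_compl hs, measure_univ, ENNReal.toReal_one]
  have hαc : (α : Measure X) K ≤ c := hmax hα
  have hβc : (β : Measure X) K ≤ c := hmax hβ
  have hcfin : c ≠ ∞ := measure_ne_top _ _
  have hreal : a * ((α : Measure X) K).toReal + b * ((β : Measure X) K).toReal
      = ((ν : Measure X) K).toReal := by
    conv_rhs => rw [hdecomp]
    rw [Measure.add_apply, Measure.smul_apply, Measure.smul_apply, smul_eq_mul, smul_eq_mul,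
      ENNReal.toReal_add (ENNReal.mul_ne_top (measure_ne_top _ _) (measure_ne_top _ _))
        (ENNReal.mul_ne_top (measure_ne_top _ _) (measure_ne_top _ _)),
      ENNReal.toReal_mul, ENNReal.toReal_mul]
  have e1 : ((α : Measure X) K).toReal ≤ c.toReal := ENNReal.toReal_mono hcfin hαc
  have e2 : ((β : Measure X) K).toReal ≤ c.toReal := ENNReal.toReal_mono hcfin hβc
  have e3 : c.toReal ≤ ((ν : Measure X) K).toReal :=
    ENNReal.toReal_mono (measure_ne_top _ _) hν.2
  -- Two numbers at most `c` whose weighted mean is at least `c` both equal `c`, so `α` and `β` stay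
  -- in `S`.
  have f1 : c.toReal ≤ ((α : Measure X) K).toReal := by
    by_contra! hlt
    have := mul_lt_mul_of_pos_left hlt ha0
    have := mul_le_mul_of_nonneg_left e2 hb0.le
    have : a * c.toReal + b * c.toReal = c.toReal := by rw [← add_mul, hab, one_mul]
    linarith
  have f2 : c.toReal ≤ ((β : Measure X) K).toReal := by
    by_contra! hlt
    have := mul_lt_mul_of_pos_left hlt hb0
    have := mul_le_mul_of_nonneg_left e1 ha0.le
    have : a * c.toReal + b * c.toReal = c.toReal := by rw [← add_mul, hab, one_mul]
    linarith
  have hαS : α ∈ S := ⟨hα, (ENNReal.toReal_le_toReal hcfin (measure_ne_top _ _)).1 f1⟩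
  have hβS : β ∈ S := ⟨hβ, (ENNReal.toReal_le_toReal hcfin (measure_ne_top _ _)).1 f2⟩
  have hseg : J ν ∈ openSegment ℝ (J α) (J β) := by
    refine ⟨a, b, ha0, hb0, hab, ?_⟩
    ext φ
    change a * ∫ x, φ x ∂(α : Measure X) + b * ∫ x, φ x ∂(β : Measure X) =
      ∫ x, φ x ∂(ν : Measure X)
    conv_rhs => rw [hdecomp]
    rw [integral_add_measure, integral_smul_measure, integral_smul_measure]
    · rfl
    · exact (integrable_of_continuous φ.continuous _).smul_measure (measure_ne_top _ _)
    · exact (integrable_of_continuous φ.continuous _).smul_measure (measure_ne_top _ _)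
  have hαν : α = ν := probabilityMeasure_ext_of_integral fun φ ↦
    congrFun (hext ⟨α, hαS, rfl⟩ ⟨β, hβS, rfl⟩ hseg) φ
  apply h1
  rw [← hαν]
  simp [α, ProbabilityTheory.cond_apply hs]

end Measures

/-! ### Mean ergodic theorem for a single ergodic measure -/

section MeanErgodic

variable {G X : Type*} [Group G] [TopologicalSpace X] [CompactSpace X] [MetrizableSpace X]
  [MeasurableSpace X] [BorelSpace X] [MulAction G X] [ContinuousConstSMul G X]

omit [TopologicalSpace X] [CompactSpace X] [MetrizableSpace X] [BorelSpace X]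
  [ContinuousConstSMul G X] in
/-- An almost invariant function is almost everywhere constant for an ergodic measure. -/
theorem exists_ae_eq_const_of_ergodicSMul {μ : Measure X} [ErgodicSMul G X μ] {f : X → ℝ}
    (hf : NullMeasurable f μ) (h : ∀ g : G, (fun x ↦ f (g • x)) =ᵐ[μ] f) :
    ∃ c : ℝ, f =ᵐ[μ] Function.const X c := by
  refine Filter.exists_eventuallyEq_const_of_forall_separating MeasurableSet fun U hU ↦ ?_
  have := aeconst_of_forall_preimage_smul_ae_eq G (hf hU) fun g ↦ by
    refine ((h g).mono fun x hx ↦ ?_).set_eq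
    simp only [Set.mem_preimage, hx]
  exact Filter.eventuallyConst_set.1 this

/-- Translation of continuous functions by a group element. -/
def translate (g : G) : C(X, ℝ) →ₗ[ℝ] C(X, ℝ) :=
  (ContinuousMap.compRightAlgHom ℝ ℝ ⟨(g • ·), continuous_const_smul g⟩).toLinearMap

omit [CompactSpace X] [MetrizableSpace X] [MeasurableSpace X] [BorelSpace X] in
@[simp]
theorem translate_apply (g : G) (h : C(X, ℝ)) (x : X) : translate g h x = h (g • x) := rfl

omit [CompactSpace X] [MetrizableSpace X] [MeasurableSpace X] [BorelSpace X] in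
theorem translate_translate (g k : G) (h : C(X, ℝ)) :
    translate g (translate k h) = translate (k * g) h := by
  ext x
  simp [mul_smul]

omit [MetrizableSpace X] [MeasurableSpace X] [BorelSpace X] in
theorem norm_translate_le (g : G) (h : C(X, ℝ)) : ‖translate g h‖ ≤ ‖h‖ :=
  (ContinuousMap.norm_le _ (norm_nonneg h)).2 fun x ↦ h.norm_coe_le_norm (g • x)

omit [CompactSpace X] [MetrizableSpace X] in
theorem integral_smul_eq {μ : Measure X} [SMulInvariantMeasure G X μ] (g : G) (f : X → ℝ) :
    ∫ x, f (g • x) ∂μ = ∫ x, f x ∂μ :=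
  (measurePreserving_smul g μ).integral_comp
    (Homeomorph.smul g).measurableEmbedding f

/-- The convex hull of the orbit of a continuous function. -/
def orbitHull (G : Type*) {X : Type*} [Group G] [TopologicalSpace X] [MulAction G X]
    [ContinuousConstSMul G X] (h : C(X, ℝ)) : Set C(X, ℝ) :=
  convexHull ℝ (Set.range fun g : G ↦ translate g h)

omit [CompactSpace X] [MetrizableSpace X] [MeasurableSpace X] [BorelSpace X] in
theorem translate_mem_orbitHull (g : G) {h φ : C(X, ℝ)} (hφ : φ ∈ orbitHull G h) :
    translate g φ ∈ orbitHull G h := by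
  have hsub : orbitHull G h ⊆ translate g ⁻¹' orbitHull G h := by
    refine convexHull_min ?_ ((convex_convexHull ℝ _).linear_preimage (translate g))
    rintro _ ⟨k, rfl⟩
    rw [Set.mem_preimage, translate_translate]
    exact subset_convexHull ℝ _ ⟨k * g, rfl⟩
  exact hsub hφ

theorem integral_eq_of_mem_orbitHull {μ : Measure X} [IsProbabilityMeasure μ]
    [SMulInvariantMeasure G X μ] {h φ : C(X, ℝ)} (hφ : φ ∈ orbitHull G h) :
    ∫ x, φ x ∂μ = ∫ x, h x ∂μ := by
  have hsub : orbitHull G h ⊆ {ψ | ∫ x, ψ x ∂μ = ∫ x, h x ∂μ} := by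
    refine convexHull_min ?_ ?_
    · rintro _ ⟨k, rfl⟩
      exact integral_smul_eq k h
    · intro a ha b hb s t _ _ hst
      simp only [Set.mem_ofPred_eq] at ha hb ⊢
      simp only [ContinuousMap.add_apply, ContinuousMap.smul_apply, smul_eq_mul]
      rw [integral_add ((integrable_of_continuous a.continuous μ).const_mul s)
        ((integrable_of_continuous b.continuous μ).const_mul t), integral_const_mul,
        integral_const_mul, ha, hb, ← add_mul, hst, one_mul]
  exact hsub hφ

-- Passes from `L²`, where the least-norm argument takes place, to the `L¹` estimates used
-- afterwards.
omit [MetrizableSpace X] in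
theorem integral_abs_le_norm_toLp (μ : Measure X) [IsProbabilityMeasure μ] (ψ : C(X, ℝ)) :
    ∫ x, |ψ x| ∂μ ≤ ‖ContinuousMap.toLp (E := ℝ) 2 μ ℝ ψ‖ := by
  have h1 : ∫ x, |ψ x| ∂μ = (eLpNorm ψ 1 μ).toReal := by
    rw [eLpNorm_one_eq_lintegral_enorm]
    exact integral_norm_eq_lintegral_enorm ψ.continuous.aestronglyMeasurable
  rw [h1, Lp.norm_def, eLpNorm_congr_ae (ContinuousMap.coeFn_toLp (p := 2) (𝕜 := ℝ) μ ψ)]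
  refine ENNReal.toReal_mono ?_ (eLpNorm_le_eLpNorm_of_exponent_le (by norm_num)
    ψ.continuous.aestronglyMeasurable)
  rw [← eLpNorm_congr_ae (ContinuousMap.coeFn_toLp (p := 2) (𝕜 := ℝ) μ ψ)]
  exact Lp.eLpNorm_ne_top _

/-- A point of least norm in a convex set is fixed by every norm-preserving self-map. -/
theorem eq_of_norm_eq_iInf {H : Type*} [NormedAddCommGroup H] [InnerProductSpace ℝ H]
    {C : Set H} (hC : Convex ℝ C) {v w : H} (hv : v ∈ C) (hw : w ∈ C)
    (hmin : ‖0 - v‖ = ⨅ u : C, ‖0 - (u : H)‖) (hvw : ‖w‖ = ‖v‖) : w = v := by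
  have h1 := (norm_eq_iInf_iff_real_inner_le_zero hC hv).1 hmin w hw
  rw [zero_sub, inner_neg_left] at h1
  have h2 := norm_add_sq_real v (w - v)
  rw [add_sub_cancel, hvw] at h2
  have h3 : ‖w - v‖ ^ 2 ≤ 0 := by linarith
  exact sub_eq_zero.1 (norm_eq_zero.1 (pow_eq_zero_iff two_ne_zero |>.1
    (le_antisymm h3 (sq_nonneg _))))

/-- The mean ergodic theorem: averages of `h` along the action come close to the constant `∫ h`. -/
theorem exists_mem_orbitHull_integral_abs_sub_lt (μ : Measure X) [IsProbabilityMeasure μ]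
    [ErgodicSMul G X μ] (h : C(X, ℝ)) {δ : ℝ} (hδ : 0 < δ) :
    ∃ φ ∈ orbitHull G h, ∫ x, |φ x - ∫ y, h y ∂μ| ∂μ < δ := by
  let T : C(X, ℝ) →L[ℝ] Lp ℝ 2 μ := ContinuousMap.toLp 2 μ ℝ
  let C : Set (Lp ℝ 2 μ) := closure (T '' orbitHull G h)
  have hconv : Convex ℝ C := ((convex_convexHull ℝ _).linear_image T.toLinearMap).closure
  have hne : C.Nonempty :=
    ⟨T (translate 1 h), subset_closure ⟨_, subset_convexHull ℝ _ ⟨1, rfl⟩, rfl⟩⟩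
  obtain ⟨v, hv, hmin⟩ :=
    exists_norm_eq_iInf_of_complete_convex hne isClosed_closure.isComplete hconv 0
  -- Translations are isometries preserving `C`, so they fix its point of least norm; ergodicity
  -- then makes `v` constant.
  have hfix : ∀ g : G, DomMulAct.mk g • v = v := by
    intro g
    refine eq_of_norm_eq_iInf hconv hv ?_ hmin (DomMulAct.norm_smul_Lp _ _)
    refine map_mem_closure (continuous_const_smul (DomMulAct.mk g)) hv ?_
    rintro _ ⟨φ, hφ, rfl⟩
    exact ⟨translate g φ, translate_mem_orbitHull g hφ, rfl⟩
  obtain ⟨c, hc⟩ := exists_ae_eq_const_of_ergodicSMul (G := G) (μ := μ) (f := v)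
    (Lp.aestronglyMeasurable v).aemeasurable.nullMeasurable fun g ↦ by
      have := DomMulAct.smul_Lp_ae_eq (DomMulAct.mk g) v
      rw [hfix g] at this
      exact this.symm
  have hvT : v = T (ContinuousMap.const X c) := by
    apply Lp.ext
    exact hc.trans (ContinuousMap.coeFn_toLp μ (ContinuousMap.const X c)).symm
  obtain ⟨_, ⟨φ, hφ, rfl⟩, hdist⟩ := Metric.mem_closure_iff.1 hv (δ / 2) (half_pos hδ)
  have hφc : ∫ x, |φ x - c| ∂μ < δ / 2 := by
    refine (integral_abs_le_norm_toLp μ (φ - ContinuousMap.const X c)).trans_lt ?_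
    rw [map_sub, ← dist_eq_norm, dist_comm]
    rwa [hvT] at hdist
  have hint : ∀ a : ℝ, Integrable (fun x ↦ |φ x - a|) μ := fun a ↦
    integrable_of_continuous (by fun_prop) μ
  -- The constant `c` is identified only approximately, through `∫ φ = ∫ h` on the hull; hence the
  -- tolerance `δ / 2` above.
  have hcm : |c - ∫ y, h y ∂μ| ≤ ∫ x, |φ x - c| ∂μ := by
    rw [← integral_eq_of_mem_orbitHull hφ, abs_sub_comm]
    calc |∫ y, φ y ∂μ - c| = |∫ y, (φ y - c) ∂μ| := by
          rw [integral_sub (integrable_of_continuous φ.continuous μ) (integrable_const c)]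
          simp
      _ ≤ ∫ x, |φ x - c| ∂μ := abs_integral_le_integral_abs
  refine ⟨φ, hφ, ?_⟩
  calc ∫ x, |φ x - ∫ y, h y ∂μ| ∂μ ≤ ∫ x, (|φ x - c| + |c - ∫ y, h y ∂μ|) ∂μ :=
        integral_mono (hint _) ((hint c).add (integrable_const _)) fun x ↦ abs_sub_le _ _ _
    _ = ∫ x, |φ x - c| ∂μ + |c - ∫ y, h y ∂μ| := by
        rw [integral_add (hint c) (integrable_const _)]
        simp
    _ < δ := by linarith

end MeanErgodic

/-! ### Følner averages, uniformly over ergodic measures -/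

section Averages

variable {G X : Type*} [Group G] [TopologicalSpace X] [CompactSpace X] [MetrizableSpace X]
  [MeasurableSpace X] [BorelSpace X] [MulAction G X] [ContinuousConstSMul G X]

/-- The average of the translates of `h` by the elements of `F`. -/
noncomputable def orbitAverage (F : Finset G) : C(X, ℝ) →ₗ[ℝ] C(X, ℝ) :=
  (F.card : ℝ)⁻¹ • ∑ g ∈ F, translate g

omit [CompactSpace X] [MetrizableSpace X] [MeasurableSpace X] [BorelSpace X] in
theorem orbitAverage_def (F : Finset G) (h : C(X, ℝ)) :
    orbitAverage F h = (F.card : ℝ)⁻¹ • ∑ g ∈ F, translate g h := by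
  simp [orbitAverage]

omit [CompactSpace X] [MetrizableSpace X] [MeasurableSpace X] [BorelSpace X] in
theorem orbitAverage_apply (F : Finset G) (h : C(X, ℝ)) (x : X) :
    orbitAverage F h x = (F.card : ℝ)⁻¹ * ∑ g ∈ F, h (g • x) := by
  simp [orbitAverage_def]

theorem norm_sum_sub_sum_le {ι E : Type*} [DecidableEq ι] [SeminormedAddCommGroup E]
    (A B : Finset ι) (u : ι → E) {r : ℝ} (hu : ∀ i, ‖u i‖ ≤ r) :
    ‖∑ i ∈ A, u i - ∑ i ∈ B, u i‖ ≤ (A ∆ B).card * r := by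
  rw [← Finset.sum_sdiff_sub_sum_sdiff]
  have hcard : (A ∆ B).card = (A \ B).card + (B \ A).card :=
    Finset.card_union_of_disjoint disjoint_sdiff_sdiff
  rw [hcard, Nat.cast_add, add_mul]
  refine (norm_sub_le _ _).trans (add_le_add ?_ ?_)
  · exact (norm_sum_le_of_le _ fun i _ ↦ hu i).trans (by simp)
  · exact (norm_sum_le_of_le _ fun i _ ↦ hu i).trans (by simp)

-- Translating by `k` reindexes the sum from `F` to `k • F`, so only the symmetric difference
-- contributes.
omit [MetrizableSpace X] [MeasurableSpace X] [BorelSpace X] in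
theorem norm_orbitAverage_translate_sub_le [DecidableEq G] (F : Finset G) (k : G) (h : C(X, ℝ)) :
    ‖orbitAverage F (translate k h) - orbitAverage F h‖ ≤
      (((k • F) ∆ F).card / F.card : ℝ) * ‖h‖ := by
  have hsum : ∑ g ∈ F, translate g (translate k h) = ∑ g ∈ k • F, translate g h := by
    rw [Finset.smul_finset_def, Finset.sum_image (by simp)]
    simp [translate_translate]
  rw [orbitAverage_def, orbitAverage_def, hsum, ← smul_sub, norm_smul, norm_inv,
    Real.norm_natCast, div_mul_eq_mul_div, div_eq_inv_mul]
  exact mul_le_mul_of_nonneg_left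
    (norm_sum_sub_sum_le _ _ (fun g ↦ translate g h) fun g ↦ norm_translate_le g h) (by positivity)

theorem integral_abs_orbitAverage_sub_le {μ : Measure X} [IsProbabilityMeasure μ]
    [SMulInvariantMeasure G X μ] {F : Finset G} (hF : F.Nonempty) (φ : C(X, ℝ)) (c : ℝ) :
    ∫ x, |orbitAverage F φ x - c| ∂μ ≤ ∫ x, |φ x - c| ∂μ := by
  have hcard : (F.card : ℝ) ≠ 0 := by simpa using hF.ne_empty
  have hint : ∀ g ∈ F, Integrable (fun x ↦ |φ (g • x) - c|) μ := fun g _ ↦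
    integrable_of_continuous (by fun_prop) μ
  calc ∫ x, |orbitAverage F φ x - c| ∂μ
      ≤ ∫ x, (F.card : ℝ)⁻¹ * ∑ g ∈ F, |φ (g • x) - c| ∂μ := by
        refine integral_mono (integrable_of_continuous (by fun_prop) μ)
          ((integrable_finsetSum _ hint).const_mul _) fun x ↦ ?_
        have : orbitAverage F φ x - c = (F.card : ℝ)⁻¹ * ∑ g ∈ F, (φ (g • x) - c) := by
          rw [orbitAverage_apply, Finset.sum_sub_distrib, Finset.sum_const, nsmul_eq_mul]
          field_simp
        simp only [this, abs_mul, abs_inv, Nat.abs_cast]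
        exact mul_le_mul_of_nonneg_left (Finset.abs_sum_le_sum_abs _ _) (by positivity)
    _ = (F.card : ℝ)⁻¹ * ∑ g ∈ F, ∫ x, |φ x - c| ∂μ := by
        rw [integral_const_mul, integral_finsetSum _ hint]
        congr 1
        exact Finset.sum_congr rfl fun g _ ↦ integral_smul_eq g fun x ↦ |φ x - c|
    _ = ∫ x, |φ x - c| ∂μ := by
        rw [Finset.sum_const, nsmul_eq_mul]
        field_simp

open Classical in
/-- An amenable group has a Følner net. -/
theorem IsAmenable.exists_folner (hG : IsAmenable G) : ∃ F : Finset G × ℕ → Finset G,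
    (∀ i, (F i).Nonempty) ∧ ∀ g : G, Filter.Tendsto
      (fun i ↦ (((g • F i) ∆ F i).card / (F i).card : ℝ)) Filter.atTop (𝓝 0) := by
  choose F hne hF using fun i : Finset G × ℕ ↦
    hG i.1 (1 / ((i.2 : ℝ) + 1)) (by positivity)
  refine ⟨F, hne, fun g ↦ ?_⟩
  have hlim : Filter.Tendsto (fun i : Finset G × ℕ ↦ 1 / ((i.2 : ℝ) + 1)) Filter.atTop (𝓝 0) := by
    rw [← Filter.prod_atTop_atTop_eq]
    exact tendsto_one_div_add_atTop_nhds_zero_nat.comp Filter.tendsto_snd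
  refine squeeze_zero' (Filter.Eventually.of_forall fun i ↦ by positivity) ?_ hlim
  filter_upwards [Filter.eventually_ge_atTop (({g}, 0) : Finset G × ℕ)] with i hi
  rw [div_le_iff₀ (by exact_mod_cast (hne i).card_pos)]
  exact hF i g (hi.1 (Finset.mem_singleton_self g))

-- The property is convex in `φ`, so translates suffice. Convergence is in sup norm, hence uniform
-- over all measures.
omit [MetrizableSpace X] [MeasurableSpace X] [BorelSpace X] in
open Classical in
theorem tendsto_orbitAverage_sub_of_mem_orbitHull {ι : Type*} {l : Filter ι} {F : ι → Finset G}
    (hF : ∀ g : G, Filter.Tendsto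
      (fun i ↦ (((g • F i) ∆ F i).card / (F i).card : ℝ)) l (𝓝 0))
    {h φ : C(X, ℝ)} (hφ : φ ∈ orbitHull G h) :
    Filter.Tendsto (fun i ↦ orbitAverage (F i) φ - orbitAverage (F i) h) l (𝓝 0) := by
  have hsub : orbitHull G h ⊆ {ψ | Filter.Tendsto
      (fun i ↦ orbitAverage (F i) ψ - orbitAverage (F i) h) l (𝓝 0)} := by
    refine convexHull_min ?_ ?_
    · rintro _ ⟨k, rfl⟩
      refine squeeze_zero_norm (fun i ↦ norm_orbitAverage_translate_sub_le (F i) k h) ?_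
      simpa using (hF k).mul_const ‖h‖
    · intro a ha b hb s t _ _ hst
      have := (Filter.Tendsto.const_smul ha s).add (Filter.Tendsto.const_smul hb t)
      simp only [smul_zero, add_zero] at this
      refine this.congr fun i ↦ ?_
      rw [map_add, map_smul, map_smul]
      have h1 : orbitAverage (F i) h = s • orbitAverage (F i) h + t • orbitAverage (F i) h := by
        rw [← add_smul, hst, one_smul]
      conv_rhs => rw [h1]
      module
  exact hsub hφ

/-- Over a compact set of ergodic measures, the Følner averages of a continuous function converge
uniformly in mean to its integrals. -/
theorem exists_integral_abs_sub_integral_lt (hG : IsAmenable G)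
    (hE : IsCompact (ergodicMeasures G X)) (h : C(X, ℝ)) {δ : ℝ} (hδ : 0 < δ) :
    ∃ θ : C(X, ℝ), ∀ μ ∈ ergodicMeasures G X,
      ∫ x, |θ x - ∫ y, h y ∂(μ : Measure X)| ∂(μ : Measure X) < δ := by
  classical
  obtain ⟨F, hne, hF⟩ := hG.exists_folner
  suffices H : ∀ᶠ i in Filter.atTop, ∀ μ ∈ ergodicMeasures G X,
      ∫ x, |orbitAverage (F i) h x - ∫ y, h y ∂(μ : Measure X)| ∂(μ : Measure X) < δ by
    obtain ⟨i, hi⟩ := H.exists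
    exact ⟨_, hi⟩
  refine hE.induction_on (p := fun s ↦ ∀ᶠ i in Filter.atTop, ∀ μ ∈ s,
      ∫ x, |orbitAverage (F i) h x - ∫ y, h y ∂(μ : Measure X)| ∂(μ : Measure X) < δ)
    (by simp) (fun s t hst ht ↦ ht.mono fun i hi μ hμ ↦ hi μ (hst hμ))
    (fun s t hs ht ↦ ?_) fun μ hμ ↦ ?_
  · filter_upwards [hs, ht] with i h1 h2 μ hμ
    exact hμ.elim (h1 μ) (h2 μ)
  have hμ' : ErgodicSMul G X (μ : Measure X) := hμ
  set c := ∫ y, h y ∂(μ : Measure X) with hc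
  obtain ⟨φ, hφ, hφδ⟩ :=
    exists_mem_orbitHull_integral_abs_sub_lt (G := G) (μ : Measure X) h (by positivity : 0 < δ / 3)
  -- Since `ψ` is continuous, the `L¹` estimate for the same `φ` persists on a weak* neighbourhood
  -- of `μ`.
  let ψ : C(X, ℝ) := ⟨fun x ↦ |φ x - c|, by fun_prop⟩
  have hN : {ν : ProbabilityMeasure X | ∫ x, ψ x ∂(ν : Measure X) < δ / 3} ∩
      {ν : ProbabilityMeasure X | |∫ x, h x ∂(ν : Measure X) - c| < δ / 3} ∈ 𝓝 μ := by
    refine Filter.inter_mem (IsOpen.mem_nhds ?_ hφδ) (IsOpen.mem_nhds ?_ ?_)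
    · exact isOpen_lt (ProbabilityMeasure.continuous_integral_continuousMap ψ) continuous_const
    · exact isOpen_lt ((ProbabilityMeasure.continuous_integral_continuousMap h).sub
        continuous_const).abs continuous_const
    · simpa [hc] using hδ
  refine ⟨_, inter_mem_nhdsWithin _ hN, ?_⟩
  have hlim := tendsto_orbitAverage_sub_of_mem_orbitHull hF hφ
  filter_upwards [Metric.tendsto_nhds.1 hlim (δ / 3) (by positivity)] with i hi ν hν
  obtain ⟨hνE, hν1, hν2⟩ := hν
  have hν' : ErgodicSMul G X (ν : Measure X) := hνE
  rw [dist_zero_right, norm_sub_rev] at hi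
  set d := ∫ y, h y ∂(ν : Measure X) with hd
  have hint : Integrable (fun x ↦ |orbitAverage (F i) φ x - c|) (ν : Measure X) :=
    integrable_of_continuous (by fun_prop) _
  calc ∫ x, |orbitAverage (F i) h x - d| ∂(ν : Measure X)
      ≤ ∫ x, (|orbitAverage (F i) φ x - c| + (‖orbitAverage (F i) h - orbitAverage (F i) φ‖
          + |d - c|)) ∂(ν : Measure X) := by
        refine integral_mono (integrable_of_continuous (by fun_prop) _)
          (hint.add (integrable_const _)) fun x ↦ ?_
        have h1 := ContinuousMap.norm_coe_le_norm (orbitAverage (F i) h - orbitAverage (F i) φ) x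
        rw [ContinuousMap.sub_apply, Real.norm_eq_abs] at h1
        have h2 := abs_add_three (orbitAverage (F i) h x - orbitAverage (F i) φ x)
          (orbitAverage (F i) φ x - c) (c - d)
        rw [abs_sub_comm c d] at h2
        have h3 : orbitAverage (F i) h x - orbitAverage (F i) φ x +
          (orbitAverage (F i) φ x - c) + (c - d) = orbitAverage (F i) h x - d := by ring
        rw [h3] at h2
        simp only
        linarith
    _ = ∫ x, |orbitAverage (F i) φ x - c| ∂(ν : Measure X) +
          (‖orbitAverage (F i) h - orbitAverage (F i) φ‖ + |d - c|) := by
        rw [integral_add hint (integrable_const _)]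
        simp
    _ < δ := by
        have h1 := integral_abs_orbitAverage_sub_le (μ := (ν : Measure X)) (hne i) φ c
        have h2 : ∫ x, |φ x - c| ∂(ν : Measure X) < δ / 3 := hν1
        have h3 : |d - c| < δ / 3 := hν2
        linarith

end Averages

/-! ### Simulating a function of the measure by a function on `X` -/

section Approximation

variable {G X : Type*} [Group G] [TopologicalSpace X] [CompactSpace X] [MetrizableSpace X]
  [MeasurableSpace X] [BorelSpace X] [MulAction G X] [ContinuousConstSMul G X]

/-- The continuous functions `t` on the space of ergodic measures for which some continuous function
on `X` is close to the constant `t μ` in the mean with respect to `μ`, uniformly in `μ`. -/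
def meanApproximable (G X : Type*) [Group G] [TopologicalSpace X] [CompactSpace X]
    [MetrizableSpace X] [MeasurableSpace X] [BorelSpace X] [MulAction G X]
    [CompactSpace (ergodicMeasures G X)] : Subalgebra ℝ C(ergodicMeasures G X, ℝ) where
  carrier := {t | ∀ δ : ℝ, 0 < δ → ∃ θ : C(X, ℝ), ∀ μ : ergodicMeasures G X,
    ∫ x, |θ x - t μ| ∂(μ : Measure X) < δ}
  algebraMap_mem' r δ hδ := ⟨ContinuousMap.const X r, fun μ ↦ by simpa using hδ⟩
  add_mem' := by
    intro t t' ht ht' δ hδ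
    obtain ⟨θ, hθ⟩ := ht (δ / 2) (half_pos hδ)
    obtain ⟨θ', hθ'⟩ := ht' (δ / 2) (half_pos hδ)
    refine ⟨θ + θ', fun μ ↦ ?_⟩
    have i1 : Integrable (fun x ↦ |θ x - t μ|) (μ : Measure X) :=
      integrable_of_continuous (by fun_prop) _
    have i2 : Integrable (fun x ↦ |θ' x - t' μ|) (μ : Measure X) :=
      integrable_of_continuous (by fun_prop) _
    calc ∫ x, |(θ + θ') x - (t + t') μ| ∂(μ : Measure X)
        ≤ ∫ x, (|θ x - t μ| + |θ' x - t' μ|) ∂(μ : Measure X) := by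
          refine integral_mono (integrable_of_continuous (by fun_prop) _) (i1.add i2) fun x ↦ ?_
          simp only [ContinuousMap.add_apply, add_sub_add_comm]
          exact abs_add_le _ _
      _ < δ := by
          rw [integral_add i1 i2]
          linarith [hθ μ, hθ' μ]
  mul_mem' := by
    intro t t' ht ht' δ hδ
    -- `θ'` comes first because the tolerance for `θ` depends on `‖θ'‖`.
    obtain ⟨θ', hθ'⟩ := ht' (δ / 2 / (‖t‖ + 1)) (by positivity)
    obtain ⟨θ, hθ⟩ := ht (δ / 2 / (‖θ'‖ + 1)) (by positivity)
    refine ⟨θ * θ', fun μ ↦ ?_⟩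
    have i1 : Integrable (fun x ↦ |θ x - t μ|) (μ : Measure X) :=
      integrable_of_continuous (by fun_prop) _
    have i2 : Integrable (fun x ↦ |θ' x - t' μ|) (μ : Measure X) :=
      integrable_of_continuous (by fun_prop) _
    have h1 := (lt_div_iff₀ (by positivity)).1 (hθ μ)
    have h2 := (lt_div_iff₀ (by positivity)).1 (hθ' μ)
    calc ∫ x, |(θ * θ') x - (t * t') μ| ∂(μ : Measure X)
        ≤ ∫ x, (|θ x - t μ| * (‖θ'‖ + 1) + |θ' x - t' μ| * (‖t‖ + 1)) ∂(μ : Measure X) := by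
          refine integral_mono (integrable_of_continuous (by fun_prop) _)
            ((i1.mul_const _).add (i2.mul_const _)) fun x ↦ ?_
          have e : (θ * θ') x - (t * t') μ = (θ x - t μ) * θ' x + (θ' x - t' μ) * t μ := by
            simp only [ContinuousMap.mul_apply]
            ring
          simp only [e]
          refine (abs_add_le _ _).trans ?_
          rw [abs_mul, abs_mul]
          have b1 : |θ' x| ≤ ‖θ'‖ + 1 := (θ'.norm_coe_le_norm x).trans (by linarith)
          have b2 : |t μ| ≤ ‖t‖ + 1 := (t.norm_coe_le_norm μ).trans (by linarith)
          gcongr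
      _ < δ := by
          rw [integral_add (i1.mul_const _) (i2.mul_const _), integral_mul_const,
            integral_mul_const]
          linarith

/-- Stone–Weierstrass: the functions `μ ↦ ∫ φ dμ` lie in the subalgebra by the Følner estimate and
separate measures. The defining property survives uniform limits. -/
theorem mem_meanApproximable [CompactSpace (ergodicMeasures G X)]
    (hG : IsAmenable G) (t : C(ergodicMeasures G X, ℝ)) : t ∈ meanApproximable G X := by
  have hsep : (meanApproximable G X).SeparatesPoints := by
    intro μ ν hμν
    by_contra H
    apply hμν
    apply Subtype.ext
    refine probabilityMeasure_ext_of_integral fun φ ↦ ?_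
    by_contra hφ
    let t : C(ergodicMeasures G X, ℝ) := ⟨fun ρ ↦ ∫ x, φ x ∂(ρ : Measure X),
      (ProbabilityMeasure.continuous_integral_continuousMap φ).comp continuous_subtype_val⟩
    refine H ⟨t, ⟨t, fun δ hδ ↦ ?_, rfl⟩, hφ⟩
    obtain ⟨θ, hθ⟩ :=
      exists_integral_abs_sub_integral_lt hG (isCompact_iff_compactSpace.2 inferInstance) φ hδ
    exact ⟨θ, fun ρ ↦ hθ ρ ρ.2⟩
  have htop := ContinuousMap.subalgebra_topologicalClosure_eq_top_of_separatesPoints _ hsep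
  intro δ hδ
  have ht : t ∈ closure (meanApproximable G X : Set C(ergodicMeasures G X, ℝ)) := by
    rw [← Subalgebra.topologicalClosure_coe, htop]
    trivial
  obtain ⟨s, hs, hts⟩ := Metric.mem_closure_iff.1 ht (δ / 2) (half_pos hδ)
  obtain ⟨θ, hθ⟩ := hs (δ / 2) (half_pos hδ)
  refine ⟨θ, fun μ ↦ ?_⟩
  have i1 : Integrable (fun x ↦ |θ x - s μ|) (μ : Measure X) :=
    integrable_of_continuous (by fun_prop) _
  have hd : |s μ - t μ| < δ / 2 := by
    rw [← Real.dist_eq, dist_comm]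
    exact (ContinuousMap.dist_apply_le_dist μ).trans_lt hts
  calc ∫ x, |θ x - t μ| ∂(μ : Measure X)
      ≤ ∫ x, (|θ x - s μ| + |s μ - t μ|) ∂(μ : Measure X) :=
        integral_mono (integrable_of_continuous (by fun_prop) _)
          (i1.add (integrable_const _)) fun x ↦ abs_sub_le _ _ _
    _ < δ := by
        rw [integral_add i1 (integrable_const _)]
        simp only [integral_const, probReal_univ, one_smul]
        linarith [hθ μ]

/-! ### Perturbing a function to have small zero sets -/

omit [TopologicalSpace X] [CompactSpace X] [MetrizableSpace X] [MeasurableSpace X]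
  [BorelSpace X] in
theorem setOf_abs_le_subset (g : X → ℝ) {a b : ℝ} (h : a ≤ b) :
    {x | |g x| ≤ a} ⊆ {x | |g x| ≤ b} :=
  fun _ (hx : |g _| ≤ a) ↦ hx.trans h

omit [CompactSpace X] [MetrizableSpace X] in
theorem exists_pos_measure_abs_le_lt (μ : Measure X) [IsFiniteMeasure μ] {g : X → ℝ}
    (hg : Continuous g) {c : ℝ≥0∞} (h : μ {x | g x = 0} < c) :
    ∃ η : ℝ, 0 < η ∧ μ {x | |g x| ≤ η} < c := by
  have hInter : ⋂ n : ℕ, {x | |g x| ≤ 1 / ((n : ℝ) + 1)} = {x | g x = 0} := by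
    ext x
    simp only [Set.mem_iInter, Set.mem_ofPred_eq]
    refine ⟨fun hx ↦ abs_eq_zero.1 (le_antisymm ?_ (abs_nonneg _)), fun hx n ↦ ?_⟩
    · exact ge_of_tendsto' tendsto_one_div_add_atTop_nhds_zero_nat hx
    · rw [hx, abs_zero]
      positivity
  have hlim := tendsto_measure_iInter_atTop (μ := μ)
    (s := fun n : ℕ ↦ {x | |g x| ≤ 1 / ((n : ℝ) + 1)})
    (fun n ↦ (isClosed_le hg.abs continuous_const).measurableSet.nullMeasurableSet)
    (fun m n hmn ↦ setOf_abs_le_subset g (Nat.one_div_le_one_div hmn)) ⟨0, measure_ne_top _ _⟩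
  rw [hInter] at hlim
  obtain ⟨n, hn⟩ := (hlim.eventually (gt_mem_nhds h)).exists
  exact ⟨1 / ((n : ℝ) + 1), by positivity, hn⟩

omit [ContinuousConstSMul G X] in
/-- Over a zero-dimensional compact space of ergodic measures, the levels at which to perturb `f`
can be chosen to depend continuously on the measure. -/
theorem exists_continuous_level [CompactSpace (ergodicMeasures G X)]
    (hzero : IsZeroDimensional (ergodicMeasures G X)) (f : C(X, ℝ)) {ε : ℝ} (hε : 0 < ε) :
    ∃ (t : C(ergodicMeasures G X, ℝ)) (η : ℝ), 0 < η ∧ (∀ μ, 0 ≤ t μ ∧ t μ ≤ ε) ∧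
      ∀ μ : ergodicMeasures G X, (μ : Measure X) {x | |f x + t μ| ≤ η} < ENNReal.ofReal ε := by
  suffices H : ∃ (C : Set (ergodicMeasures G X)) (t : C(ergodicMeasures G X, ℝ)) (η : ℝ),
      IsClopen C ∧ Set.univ ⊆ C ∧ 0 < η ∧ (∀ μ, 0 ≤ t μ ∧ t μ ≤ ε) ∧
      ∀ μ ∈ C, (μ : Measure X) {x | |f x + t μ| ≤ η} < ENNReal.ofReal ε by
    obtain ⟨C, t, η, -, hC, hη, ht, h⟩ := H
    exact ⟨t, η, hη, ht, fun μ ↦ h μ (hC trivial)⟩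
  refine isCompact_univ.induction_on (p := fun s ↦ ∃ (C : Set (ergodicMeasures G X))
      (t : C(ergodicMeasures G X, ℝ)) (η : ℝ),
      IsClopen C ∧ s ⊆ C ∧ 0 < η ∧ (∀ μ, 0 ≤ t μ ∧ t μ ≤ ε) ∧
      ∀ μ ∈ C, (μ : Measure X) {x | |f x + t μ| ≤ η} < ENNReal.ofReal ε) ?_ ?_ ?_ ?_
  · exact ⟨∅, 0, 1, isClopen_empty, subset_rfl, one_pos, by simp [hε.le], by simp⟩
  · rintro s t hst ⟨C, u, η, hC, htC, h⟩
    exact ⟨C, u, η, hC, hst.trans htC, h⟩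
  · rintro s s' ⟨C, t, η, hC, hsC, hη, ht, h⟩ ⟨C', t', η', hC', hsC', hη', ht', h'⟩
    classical
    -- Gluing across `C` is continuous because a clopen set has empty frontier.
    refine ⟨C ∪ C', ⟨C.piecewise t t', t.continuous.piecewise
      (by simp [hC.frontier_eq]) t'.continuous⟩, min η η', hC.union hC',
      Set.union_subset_union hsC hsC', lt_min hη hη', fun μ ↦ ?_, fun μ hμ ↦ ?_⟩
    · by_cases hμC : μ ∈ C
      · simpa [hμC] using ht μ
      · simpa [hμC] using ht' μ
    · by_cases hμC : μ ∈ C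
      · refine (measure_mono fun x hx ↦ ?_).trans_lt (h μ hμC)
        simp only [ContinuousMap.coe_mk, hμC, Set.piecewise_eq_of_mem, Set.mem_ofPred_eq] at hx ⊢
        exact hx.trans (min_le_left _ _)
      · refine (measure_mono fun x hx ↦ ?_).trans_lt (h' μ (hμ.resolve_left hμC))
        simp only [ContinuousMap.coe_mk, hμC, not_false_eq_true, Set.piecewise_eq_of_notMem,
          Set.mem_ofPred_eq] at hx ⊢
        exact hx.trans (min_le_right _ _)
  · intro μ _
    -- A null level `a` in `(-ε, 0)` gives the constant shift `-a`, which still works on a clopen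
    -- neighbourhood of `μ`.
    have hcount : {a : ℝ | 0 < (μ : Measure X) {x | f x = a}}.Countable :=
      Measure.countable_meas_level_set_pos f.continuous.measurable
    obtain ⟨a, ha, haI⟩ := (hcount.dense_compl ℝ).exists_mem_open isOpen_Ioo
      (Set.nonempty_Ioo.2 (neg_lt_zero.2 hε))
    have hzero' : (μ : Measure X) {x | f x + -a = 0} < ENNReal.ofReal ε := by
      have h0 : (μ : Measure X) {x | f x = a} = 0 := by simpa using ha
      simp only [← sub_eq_add_neg, sub_eq_zero, h0]
      exact ENNReal.ofReal_pos.2 hε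
    obtain ⟨η, hη, hμη⟩ := exists_pos_measure_abs_le_lt (μ : Measure X)
      (f.continuous.add continuous_const) hzero'
    have hopen : IsOpen {ν : ergodicMeasures G X |
        (ν : Measure X) {x | |f x + -a| ≤ η} < ENNReal.ofReal ε} :=
      (isOpen_setOf_measure_closed_lt
        (isClosed_le (f.continuous.add continuous_const).abs continuous_const) _).preimage
        continuous_subtype_val
    obtain ⟨C, hC, hμC, hCsub⟩ := hzero.exists_subset_of_mem_open hμη hopen
    exact ⟨C, mem_nhdsWithin_of_mem_nhds (hC.isOpen.mem_nhds hμC), C,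
      ContinuousMap.const _ (-a), η, hC, subset_rfl, hη,
      fun _ ↦ ⟨by simpa using haI.2.le, by simpa using neg_le.1 haI.1.le⟩, fun ν hν ↦ hCsub hν⟩

/-- At a zero of the perturbed function, either `f + t μ` is within `η` of zero or `θ` misses `t μ`
by at least `η`. The choice of level bounds the first event, Markov the second. -/
theorem exists_norm_sub_le_measure_zeros_lt (hG : IsAmenable G)
    [CompactSpace (ergodicMeasures G X)] (hzero : IsZeroDimensional (ergodicMeasures G X))
    (f : C(X, ℝ)) {ε : ℝ} (hε : 0 < ε) :
    ∃ g : C(X, ℝ), dist f g ≤ ε ∧ ∀ μ ∈ ergodicMeasures G X,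
      (μ : Measure X) {x | g x = 0} < ENNReal.ofReal ε + ENNReal.ofReal ε := by
  obtain ⟨t, η, hη, ht, hμ⟩ := exists_continuous_level hzero f hε
  obtain ⟨θ, hθ⟩ := mem_meanApproximable hG t (η * ε) (by positivity)
  -- Clamping to `[0, ε]` bounds the perturbation and does not increase the distance to `t μ`, which
  -- lies in that interval.
  refine ⟨f + ⟨fun x ↦ max 0 (min (θ x) ε), by fun_prop⟩, ?_, fun μ hμE ↦ ?_⟩
  · rw [dist_self_add_right]
    refine (ContinuousMap.norm_le _ hε.le).2 fun x ↦ ?_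
    rw [Real.norm_eq_abs, abs_le]
    exact ⟨(neg_nonpos.2 hε.le).trans (le_max_left _ _), max_le hε.le (min_le_right _ _)⟩
  · have hsub : {x | (f + ⟨fun x ↦ max 0 (min (θ x) ε), by fun_prop⟩ : C(X, ℝ)) x = 0} ⊆
        {x | |f x + t ⟨μ, hμE⟩| ≤ η} ∪ {x | η ≤ |θ x - t ⟨μ, hμE⟩|} := by
      intro x hx
      by_contra hcon
      simp only [Set.mem_union, Set.mem_ofPred_eq, not_or, not_le, ContinuousMap.add_apply,
        ContinuousMap.coe_mk] at hx hcon
      obtain ⟨h0, h1⟩ := ht ⟨μ, hμE⟩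
      have hclamp : |max 0 (min (θ x) ε) - t ⟨μ, hμE⟩| ≤ |θ x - t ⟨μ, hμE⟩| := by grind
      have hfx : f x = -max 0 (min (θ x) ε) := by linarith
      rw [hfx, neg_add_eq_sub, abs_sub_comm] at hcon
      linarith
    have hmarkov : (μ : Measure X) {x | η ≤ |θ x - t ⟨μ, hμE⟩|} ≤ ENNReal.ofReal ε := by
      have h1 := mul_meas_ge_le_integral_of_nonneg (μ := (μ : Measure X))
        (f := fun x ↦ |θ x - t ⟨μ, hμE⟩|) (Filter.Eventually.of_forall fun x ↦ abs_nonneg _)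
        (integrable_of_continuous (by fun_prop) _) η
      have h2 := lt_of_mul_lt_mul_left (h1.trans_lt (hθ ⟨μ, hμE⟩)) hη.le
      rw [← ofReal_measureReal]
      exact ENNReal.ofReal_le_ofReal h2.le
    exact ((measure_mono hsub).trans (measure_union_le _ _)).trans_lt
      (ENNReal.add_lt_add_of_lt_of_le (by finiteness) (hμ ⟨μ, hμE⟩) hmarkov)

/-- Over a compact set of measures, having few zeros is an open condition on the function. -/
theorem isOpen_setOf_measure_zeros_lt {E : Set (ProbabilityMeasure X)} (hE : IsCompact E)
    (c : ℝ≥0∞) : IsOpen {g : C(X, ℝ) | ∀ μ ∈ E, (μ : Measure X) {x | g x = 0} < c} := by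
  refine Metric.isOpen_iff.2 fun g hg ↦ ?_
  -- A uniform `η` suffices: zeros of any `g'` within `η` of `g` lie in `{|g| ≤ η}`.
  obtain ⟨η, hη, h⟩ : ∃ η : ℝ, 0 < η ∧ ∀ μ ∈ E, (μ : Measure X) {x | |g x| ≤ η} < c := by
    refine hE.induction_on (p := fun s ↦ ∃ η : ℝ, 0 < η ∧ ∀ μ ∈ s,
      (μ : Measure X) {x | |g x| ≤ η} < c) ⟨1, one_pos, by simp⟩ ?_ ?_ fun μ hμ ↦ ?_
    · rintro s t hst ⟨η, hη, h⟩
      exact ⟨η, hη, fun μ hμ ↦ h μ (hst hμ)⟩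
    · rintro s t ⟨η, hη, h⟩ ⟨η', hη', h'⟩
      refine ⟨min η η', lt_min hη hη', fun μ hμ ↦ hμ.elim (fun hμ ↦ ?_) fun hμ ↦ ?_⟩
      · exact (measure_mono (setOf_abs_le_subset g (min_le_left _ _))).trans_lt (h μ hμ)
      · exact (measure_mono (setOf_abs_le_subset g (min_le_right _ _))).trans_lt (h' μ hμ)
    · obtain ⟨η, hη, h⟩ := exists_pos_measure_abs_le_lt (μ : Measure X) g.continuous (hg μ hμ)
      exact ⟨_, mem_nhdsWithin_of_mem_nhds ((isOpen_setOf_measure_closed_lt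
        (isClosed_le g.continuous.abs continuous_const) c).mem_nhds h), η, hη, fun ν hν ↦ hν⟩
  refine ⟨η, hη, fun g' hg' μ hμ ↦ (measure_mono fun x hx ↦ ?_).trans_lt (h μ hμ)⟩
  have h1 := (ContinuousMap.dist_apply_le_dist (f := g') (g := g) x).trans
    (Metric.mem_ball.1 hg').le
  rw [Real.dist_eq, show g' x = 0 from hx, zero_sub, abs_neg] at h1
  exact h1

theorem dense_setOf_measure_zeros_eq_zero (hG : IsAmenable G)
    [CompactSpace (ergodicMeasures G X)] (hzero : IsZeroDimensional (ergodicMeasures G X)) :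
    Dense {g : C(X, ℝ) | ∀ μ ∈ ergodicMeasures G X, (μ : Measure X) {x | g x = 0} = 0} := by
  have hdense : Dense (⋂ n : ℕ, {g : C(X, ℝ) | ∀ μ ∈ ergodicMeasures G X,
      (μ : Measure X) {x | g x = 0} < ((n : ℝ≥0∞) + 1)⁻¹}) := by
    refine dense_iInter_of_isOpen_nat (fun n ↦ isOpen_setOf_measure_zeros_lt
      (isCompact_iff_compactSpace.2 inferInstance) _) fun n ↦ Metric.dense_iff.2 fun f r hr ↦ ?_
    have hn : (0 : ℝ) < 1 / ((n : ℝ) + 1) := by positivity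
    obtain ⟨g, hfg, hg⟩ := exists_norm_sub_le_measure_zeros_lt hG hzero f
      -- The first half makes the distance strictly less than `r`; the second absorbs the bound `ε +
      -- ε`.
      (ε := min (r / 2) (1 / ((n : ℝ) + 1) / 2)) (by positivity)
    refine ⟨g, ?_, fun μ hμ ↦ (hg μ hμ).trans_le ?_⟩
    · rw [Metric.mem_ball, dist_comm]
      exact (hfg.trans (min_le_left _ _)).trans_lt (half_lt_self hr)
    · rw [← ENNReal.ofReal_add (by positivity) (by positivity)]
      have h1 : ((n : ℝ≥0∞) + 1)⁻¹ = ENNReal.ofReal (1 / ((n : ℝ) + 1)) := by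
        rw [one_div, ENNReal.ofReal_inv_of_pos (by positivity),
          ENNReal.ofReal_add (by positivity) zero_le_one, ENNReal.ofReal_natCast,
          ENNReal.ofReal_one]
      rw [h1]
      refine ENNReal.ofReal_le_ofReal ?_
      linarith [min_le_right (r / 2) (1 / ((n : ℝ) + 1) / 2)]
  refine hdense.mono fun g hg μ hμ ↦ ?_
  by_contra hne
  obtain ⟨n, hn⟩ := ENNReal.exists_inv_nat_lt hne
  have h1 := Set.mem_iInter.1 hg n μ hμ
  have h2 : ((n : ℝ≥0∞) + 1)⁻¹ ≤ (n : ℝ≥0∞)⁻¹ := ENNReal.inv_le_inv.2 le_self_add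
  exact absurd (h1.trans_le h2) hn.not_gt

end Approximation
end SmallBoundary

/-! ### The small boundary property -/

theorem theorem1p1 {G X : Type*} [Group G] [Countable G] [Infinite G]
    (hG : SmallBoundary.IsAmenable G)
    [TopologicalSpace X] [CompactSpace X] [MetrizableSpace X] [Infinite X]
    [MeasurableSpace X] [BorelSpace X]
    [MulAction G X] [ContinuousConstSMul G X] [MulAction.IsMinimal G X]
    (hfree : SmallBoundary.IsFreeAction G X)
    (hcompact : IsCompact (SmallBoundary.ergodicMeasures G X))
    (hzero : SmallBoundary.IsZeroDimensional (SmallBoundary.ergodicMeasures G X)) :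
    SmallBoundary.HasSmallBoundaryProperty G X := by
  intro x U hU hxU
  have := isCompact_iff_compactSpace.1 hcompact
  obtain ⟨u, hu0, hu1, -⟩ := exists_continuous_zero_one_of_isClosed
    (isClosed_singleton (x := x)) hU.isClosed_compl
    (Set.disjoint_singleton_left.2 fun h ↦ h hxU)
  -- `f` is `1` at `x` and `-1` off `U`, so a perturbation smaller than `1` keeps both signs.
  let f : C(X, ℝ) := 1 - (2 : ℝ) • u
  obtain ⟨g, hfg, hg⟩ := Metric.dense_iff.1
    (SmallBoundary.dense_setOf_measure_zeros_eq_zero hG hzero) f 1 one_pos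
  have hclose : ∀ y, |g y - f y| < 1 := fun y ↦
    (ContinuousMap.dist_apply_le_dist (f := g) (g := f) y).trans_lt (Metric.mem_ball.1 hfg)
  refine ⟨{y | 0 < g y}, isOpen_lt continuous_const g.continuous, ?_, fun y hy ↦ ?_,
    fun μ hμ ↦ ?_⟩
  · have h1 : f x = 1 := by simp [f, hu0 (Set.mem_singleton x)]
    have h2 := (abs_lt.1 (hclose x)).1
    rw [h1] at h2
    simp only [Set.mem_ofPred_eq]
    linarith
  · by_contra hyU
    have h1 : f y = -1 := by
      simp [f, hu1 hyU]
      norm_num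
    have h2 := (abs_lt.1 (hclose y)).2
    rw [h1] at h2
    simp only [Set.mem_ofPred_eq] at hy
    linarith
  · obtain ⟨ν, hν, hle⟩ := SmallBoundary.exists_ergodic_measure_closed_ge hμ
      (isClosed_eq g.continuous continuous_const : IsClosed {y | g y = 0})
    refine measure_mono_null (fun y hy ↦ ?_) (le_zero_iff.1 (hle.trans (hg ν hν).le))
    exact (frontier_lt_subset_eq continuous_const g.continuous hy).symm
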